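/- Let $R$ be an associative unital ring; modules are left $R$-modules. A module $F$ is flat if $-\otimes_R F$ preserves injectivity of homomorphisms of right $R$-modules, a module $C$ is cotorsion if $\operatorname{Ext}^1_R(F,C)=0$ for every flat module $F$, and a module is flat-cotorsion if it is both flat and cotorsion. A totally acyclic complex of flat-cotorsion modules is an acyclic ($\mathbb{Z}$-indexed) complex $T=\cdots\to T_{n+1}\to T_n\to T_{n-1}\to\cdots$ of flat-cotorsion modules such that the complexes $\operatorname{Hom}_R(T,W)$ and $\operatorname{Hom}_R(W,T)$ are acyclic for every flat-cotorsion module $W$. A module $G$ is Gorenstein flat-cotorsion if there is such a complex $T$ with $G\cong Z_0(T)=\ker(T_0\to T_{-1})$. Then the class of Gorenstein flat-cotorsion $R$-modules is closed under finite direct sums and direct summands: (1) if $(G_i)_{i\in I}$ is a finite (possibly empty) family of Gorenstein flat-cotorsion modules, then $\bigoplus_{i\in I}G_i$ is Gorenstein flat-cotorsion; (2) if $M$ is Gorenstein flat-cotorsion and $M\cong G\oplus G'$ for some modules $G$ and $G'$, then $G$ is Gorenstein flat-cotorsion. -/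

import Mathlib

open CategoryTheory
open scoped TensorProduct

universe u

namespace GorensteinFlatCotorsion

section Tensor

/-- For a right `R`-module `N` (a module over `Rᵐᵒᵖ`) and a left `R`-module `F`, the subgroup of
`N ⊗[ℤ] F` generated by the elements `(n r) ⊗ f - n ⊗ (r f)`. -/
def balancingSubgroup (R N F : Type u) [Ring R] [AddCommGroup N] [Module Rᵐᵒᵖ N]
    [AddCommGroup F] [Module R F] : AddSubgroup (N ⊗[ℤ] F) :=
  AddSubgroup.closure
    {x | ∃ (n : N) (r : R) (f : F), x = (MulOpposite.op r • n) ⊗ₜ[ℤ] f - n ⊗ₜ[ℤ] (r • f)}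

/-- The tensor product `N ⊗_R F` of a right `R`-module `N` and a left `R`-module `F` over a
not necessarily commutative ring `R`, an abelian group. -/
abbrev BalancedTensor (R N F : Type u) [Ring R] [AddCommGroup N] [Module Rᵐᵒᵖ N]
    [AddCommGroup F] [Module R F] : Type u :=
  (N ⊗[ℤ] F) ⧸ balancingSubgroup R N F

/-- The homomorphism `g ⊗_ℤ F : N ⊗[ℤ] F → N' ⊗[ℤ] F` for `g : N → N'`. -/
noncomputable def intTensorMap (R : Type u) {N N' : Type u} (F : Type u) [Ring R]
    [AddCommGroup N] [Module Rᵐᵒᵖ N] [AddCommGroup N'] [Module Rᵐᵒᵖ N'] [AddCommGroup F]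
    (g : N →ₗ[Rᵐᵒᵖ] N') : N ⊗[ℤ] F →+ N' ⊗[ℤ] F :=
  (LinearMap.rTensor F g.toAddMonoidHom.toIntLinearMap).toAddMonoidHom

theorem balancingSubgroup_le_comap (R : Type u) {N N' : Type u} (F : Type u) [Ring R]
    [AddCommGroup N] [Module Rᵐᵒᵖ N] [AddCommGroup N'] [Module Rᵐᵒᵖ N']
    [AddCommGroup F] [Module R F] (g : N →ₗ[Rᵐᵒᵖ] N') :
    balancingSubgroup R N F ≤ (balancingSubgroup R N' F).comap (intTensorMap R F g) := by
  refine (AddSubgroup.closure_le _).2 ?_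
  rintro _ ⟨n, r, f, rfl⟩
  refine AddSubgroup.subset_closure ⟨g n, r, f, ?_⟩
  simp [intTensorMap]

/-- The homomorphism `g ⊗_R F : N ⊗_R F → N' ⊗_R F` induced by a homomorphism `g : N → N'` of
right `R`-modules. -/
noncomputable def balancedTensorMap (R : Type u) {N N' : Type u} (F : Type u) [Ring R]
    [AddCommGroup N] [Module Rᵐᵒᵖ N] [AddCommGroup N'] [Module Rᵐᵒᵖ N']
    [AddCommGroup F] [Module R F] (g : N →ₗ[Rᵐᵒᵖ] N') :
    BalancedTensor R N F →+ BalancedTensor R N' F :=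
  QuotientAddGroup.map _ _ (intTensorMap R F g) (balancingSubgroup_le_comap R F g)

end Tensor

variable {R : Type u} [Ring R]

/-- A left `R`-module `F` is flat if `- ⊗_R F` preserves injectivity of homomorphisms of right
`R`-modules. (Mathlib's `Module.Flat` is only available over commutative semirings.) -/
def IsFlat (F : ModuleCat.{u} R) : Prop :=
  ∀ (N N' : Type u) [AddCommGroup N] [Module Rᵐᵒᵖ N] [AddCommGroup N'] [Module Rᵐᵒᵖ N']
    (g : N →ₗ[Rᵐᵒᵖ] N'), Function.Injective g → Function.Injective (balancedTensorMap R F g)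

/-- A left `R`-module `C` is cotorsion if `Ext^1_R(F, C) = 0` for every flat `R`-module `F`. -/
def IsCotorsion (C : ModuleCat.{u} R) : Prop :=
  ∀ F : ModuleCat.{u} R, IsFlat F → Subsingleton (Abelian.Ext F C 1)

def IsFlatCotorsion (W : ModuleCat.{u} R) : Prop :=
  IsFlat W ∧ IsCotorsion W

/-- The complex of abelian groups `Hom_R(W, T)` for a module `W` and a complex `T`. -/
noncomputable abbrev homFrom (W : ModuleCat.{u} R) (T : ChainComplex (ModuleCat.{u} R) ℤ) :
    ChainComplex AddCommGrpCat.{u} ℤ :=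
  ((preadditiveCoyoneda.obj (Opposite.op W)).mapHomologicalComplex _).obj T

/-- The complex of abelian groups `Hom_R(T, W)` for a complex `T` and a module `W`; the group
`Hom_R(T_n, W)` is placed in degree `n` and the differentials raise the degree. -/
noncomputable abbrev homInto (T : ChainComplex (ModuleCat.{u} R) ℤ) (W : ModuleCat.{u} R) :
    HomologicalComplex AddCommGrpCat.{u} (ComplexShape.down ℤ).symm :=
  ((preadditiveYoneda.obj W).mapHomologicalComplex _).obj T.op

/-- `T` is a totally acyclic complex of flat-cotorsion `R`-modules. -/
structure IsTotallyAcyclic (T : ChainComplex (ModuleCat.{u} R) ℤ) : Prop where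
  isFlatCotorsion : ∀ n, IsFlatCotorsion (T.X n)
  acyclic : T.Acyclic
  acyclic_homInto : ∀ W : ModuleCat.{u} R, IsFlatCotorsion W → (homInto T W).Acyclic
  acyclic_homFrom : ∀ W : ModuleCat.{u} R, IsFlatCotorsion W → (homFrom W T).Acyclic

/-- An `R`-module `G` is Gorenstein flat-cotorsion if it is (isomorphic to) the module of cycles
in degree `0` of a totally acyclic complex of flat-cotorsion `R`-modules. -/
def IsGorensteinFlatCotorsion (G : ModuleCat.{u} R) : Prop :=
  ∃ T : ChainComplex (ModuleCat.{u} R) ℤ, IsTotallyAcyclic T ∧ Nonempty (T.cycles 0 ≅ G)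

/-- `G` is (isomorphic to) a direct summand of `M`. -/
def IsDirectSummand (G M : ModuleCat.{u} R) : Prop :=
  ∃ G' : ModuleCat.{u} R, Nonempty (M ≅ ModuleCat.of R (G × G'))

end GorensteinFlatCotorsion

/-!
# Gorenstein flat-cotorsion modules: finite sums and summands

Flat-cotorsion modules are closed under finite sums and retracts, and `Ext¹` between any two of
them vanishes. Call a class of modules a *Gorenstein class* (`IsGorensteinClass`) if it is
`Ext¹`-orthogonal on both sides to the flat-cotorsion modules and each member `X` fits into short
exact sequences `0 → X → W → Y → 0` and `0 → Y' → W' → X → 0` with `W`, `W'` flat-cotorsion and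
`Y`, `Y'` again in the class. Splicing such sequences in both directions produces a totally acyclic
complex, so the members of a Gorenstein class are Gorenstein flat-cotorsion
(`IsGorensteinClass.isGorensteinFlatCotorsion`). Conversely the cycles of a totally acyclic complex
form a Gorenstein class, hence so do all Gorenstein flat-cotorsion modules
(`isGorensteinClass_isGorensteinFlatCotorsion`). Being Gorenstein flat-cotorsion is thus the largest
Gorenstein class, and each closure property follows by exhibiting a suitable Gorenstein class.

For finite sums this is the class of finite products of Gorenstein flat-cotorsion modules.

For summands it is the class of all retracts of Gorenstein flat-cotorsion modules. Let
`0 → M → W → N → 0` be exact with `W` flat-cotorsion and `N` Gorenstein flat-cotorsion, and let `G`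
be a retract of `M`, the image of an idempotent of `M`. Since `Ext¹(N, W) = 0`, this idempotent
extends to an endomorphism `e` of `W`, in general not idempotent. Then `1 - e` vanishes on `G`, `e`
followed by `W → W/G` vanishes on `M`, and these two maps exhibit `W/G` as a retract of `W ⊕ N`
(`nonempty_retract_biprod_of_coresolution`). As `W ⊕ N` is Gorenstein flat-cotorsion, `W/G` lies in
the class. The other side is dual. No infinite sums or products are involved, which matters because
flat-cotorsion modules are in general not closed under them.
-/

namespace GorensteinFlatCotorsion

variable {R : Type u} [Ring R]

/-! ### Finite sums and retracts: flatness, and vanishing of Ext -/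

/-- The homomorphism `N ⊗_R f : N ⊗_R F → N ⊗_R F'` induced by a homomorphism `f : F → F'` of left
`R`-modules. -/
noncomputable def balancedTensorMapRight (N : Type u) {F F' : Type u} [AddCommGroup N]
    [Module Rᵐᵒᵖ N] [AddCommGroup F] [Module R F] [AddCommGroup F'] [Module R F']
    (f : F →ₗ[R] F') : BalancedTensor R N F →+ BalancedTensor R N F' :=
  QuotientAddGroup.map _ _
      (LinearMap.lTensor N f.toAddMonoidHom.toIntLinearMap).toAddMonoidHom <| by
    refine (AddSubgroup.closure_le _).2 ?_
    rintro _ ⟨n, r, x, rfl⟩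
    exact AddSubgroup.subset_closure ⟨n, r, f x, by simp⟩

theorem balancedTensor_addHom_ext {N F : Type u} {A : Type*} [AddCommGroup N]
    [Module Rᵐᵒᵖ N] [AddCommGroup F] [Module R F] [AddCommGroup A]
    {φ ψ : BalancedTensor R N F →+ A}
    (h : ∀ (n : N) (x : F),
      φ (QuotientAddGroup.mk (n ⊗ₜ[ℤ] x)) = ψ (QuotientAddGroup.mk (n ⊗ₜ[ℤ] x))) :
    φ = ψ := by
  refine QuotientAddGroup.addMonoidHom_ext _ (AddMonoidHom.ext fun t => ?_)
  induction t using TensorProduct.induction_on with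
  | zero => simp
  | tmul n x => exact h n x
  | add a b ha hb => rw [map_add, map_add, ha, hb]

theorem balancedTensorMap_right_comm {N N' F F' : Type u} [AddCommGroup N] [Module Rᵐᵒᵖ N]
    [AddCommGroup N'] [Module Rᵐᵒᵖ N'] [AddCommGroup F] [Module R F] [AddCommGroup F']
    [Module R F'] (g : N →ₗ[Rᵐᵒᵖ] N') (f : F →ₗ[R] F') (t : BalancedTensor R N F) :
    balancedTensorMap R F' g (balancedTensorMapRight N f t) =
      balancedTensorMapRight N' f (balancedTensorMap R F g t) :=
  DFunLike.congr_fun (balancedTensor_addHom_ext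
    (φ := (balancedTensorMap R F' g).comp (balancedTensorMapRight N f))
    (ψ := (balancedTensorMapRight N' f).comp (balancedTensorMap R F g)) fun _ _ => rfl) t

/-- `N ⊗_R -` preserves decompositions of the identity as a finite sum of maps that factor through
the modules `A i`. -/
theorem sum_balancedTensorMapRight {N F : Type u} [AddCommGroup N] [Module Rᵐᵒᵖ N]
    [AddCommGroup F] [Module R F] {ι : Type*} [Fintype ι] {A : ι → Type u}
    [∀ i, AddCommGroup (A i)] [∀ i, Module R (A i)] (p : ∀ i, F →ₗ[R] A i)
    (j : ∀ i, A i →ₗ[R] F) (h : ∀ x, ∑ i, j i (p i x) = x) (t : BalancedTensor R N F) :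
    ∑ i, balancedTensorMapRight N (j i) (balancedTensorMapRight N (p i) t) = t := by
  have := balancedTensor_addHom_ext (R := R) (N := N) (F := F)
    (φ := ∑ i, (balancedTensorMapRight N (j i)).comp (balancedTensorMapRight N (p i)))
    (ψ := AddMonoidHom.id _) fun n x => by
      rw [AddMonoidHom.finsetSum_apply]
      conv_rhs => rw [← h x, TensorProduct.tmul_sum]
      exact (map_sum (QuotientAddGroup.mk' (balancingSubgroup R N F)) _ _).symm
  simpa using DFunLike.congr_fun this t

section SumEqId

/- The identity of `F` being a finite sum of maps factoring through the `A i` covers finite products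
of the `A i`, retracts (one summand) and zero modules (no summand) at once. -/
variable {ι : Type*} [Fintype ι] {F : ModuleCat.{u} R} {A : ι → ModuleCat.{u} R}
  (p : ∀ i, F ⟶ A i) (j : ∀ i, A i ⟶ F) (h : ∑ i, p i ≫ j i = 𝟙 F)

include h

theorem IsFlat.of_sum_eq_id (hA : ∀ i, IsFlat (A i)) : IsFlat F := by
  intro N N' _ _ _ _ g hg
  rw [injective_iff_map_eq_zero]
  intro t ht
  have hsum (x : F) : ∑ i, (j i).hom ((p i).hom x) = x := by
    have := congr(ModuleCat.Hom.hom $h x)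
    simpa [ModuleCat.hom_sum] using this
  rw [← sum_balancedTensorMapRight (fun i => (p i).hom) (fun i => (j i).hom) hsum t]
  refine Finset.sum_eq_zero fun i _ => ?_
  have : balancedTensorMapRight N (p i).hom t = 0 := by
    refine (injective_iff_map_eq_zero _).1 (hA i N N' g hg) _ ?_
    rw [balancedTensorMap_right_comm, ht, map_zero]
  rw [this, map_zero]

theorem subsingleton_ext_left_of_sum_eq_id {X : ModuleCat.{u} R} {n : ℕ}
    (hA : ∀ i, Subsingleton (Abelian.Ext (A i) X n)) : Subsingleton (Abelian.Ext F X n) := by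
  refine subsingleton_of_forall_eq 0 fun e => ?_
  rw [← Abelian.Ext.mk₀_id_comp e, ← h, Abelian.Ext.mk₀_sum, Abelian.Ext.sum_comp]
  refine Finset.sum_eq_zero fun i _ => ?_
  rw [← Abelian.Ext.mk₀_comp_mk₀_assoc, Subsingleton.elim ((Abelian.Ext.mk₀ (j i)).comp e _) 0,
    Abelian.Ext.comp_zero]

theorem subsingleton_ext_right_of_sum_eq_id {X : ModuleCat.{u} R} {n : ℕ}
    (hA : ∀ i, Subsingleton (Abelian.Ext X (A i) n)) : Subsingleton (Abelian.Ext X F n) := by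
  refine subsingleton_of_forall_eq 0 fun e => ?_
  rw [← Abelian.Ext.comp_mk₀_id e, ← h, Abelian.Ext.mk₀_sum, Abelian.Ext.comp_sum]
  refine Finset.sum_eq_zero fun i _ => ?_
  rw [← Abelian.Ext.mk₀_comp_mk₀, ← Abelian.Ext.comp_assoc_of_third_deg_zero,
    Subsingleton.elim (e.comp (Abelian.Ext.mk₀ (p i)) _) 0, Abelian.Ext.zero_comp]

theorem IsFlatCotorsion.of_sum_eq_id (hA : ∀ i, IsFlatCotorsion (A i)) : IsFlatCotorsion F :=
  ⟨IsFlat.of_sum_eq_id p j h fun i => (hA i).1, fun _ hE =>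
    subsingleton_ext_right_of_sum_eq_id p j h fun i => (hA i).2 _ hE⟩

end SumEqId

open Abelian in
theorem subsingleton_ext_of_retract {X X' Y Y' : ModuleCat.{u} R} (r : Retract X X')
    (s : Retract Y Y') {n : ℕ} (h : Subsingleton (Ext X' Y' n)) : Subsingleton (Ext X Y n) :=
  subsingleton_ext_left_of_sum_eq_id (ι := Unit) (fun _ => r.i) (fun _ => r.r) (by simp) fun _ =>
    subsingleton_ext_right_of_sum_eq_id (ι := Unit) (fun _ => s.i) (fun _ => s.r) (by simp)
      fun _ => h

/-! ### Extending and lifting along short exact sequences -/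

section Ext
open Abelian Limits
variable {S : ShortComplex (ModuleCat.{u} R)} (hS : S.ShortExact)
include hS

theorem exists_extension {W : ModuleCat.{u} R} (h : Subsingleton (Ext S.X₃ W 1)) (φ : S.X₁ ⟶ W) :
    ∃ ψ : S.X₂ ⟶ W, S.f ≫ ψ = φ := by
  obtain ⟨e, he⟩ := Ext.contravariant_sequence_exact₁ hS W (Ext.mk₀ φ) (add_zero 1)
    (Subsingleton.elim _ _)
  obtain ⟨ψ, rfl⟩ := (Ext.mk₀_bijective _ _).2 e
  exact ⟨ψ, (Ext.mk₀_bijective _ _).1 (by rw [← he, Ext.mk₀_comp_mk₀])⟩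

theorem exists_lift {W : ModuleCat.{u} R} (h : Subsingleton (Ext W S.X₁ 1)) (φ : W ⟶ S.X₃) :
    ∃ ψ : W ⟶ S.X₂, ψ ≫ S.g = φ := by
  obtain ⟨e, he⟩ := Ext.covariant_sequence_exact₃ W hS (Ext.mk₀ φ) (zero_add 1)
    (Subsingleton.elim _ _)
  obtain ⟨ψ, rfl⟩ := (Ext.mk₀_bijective _ _).2 e
  exact ⟨ψ, (Ext.mk₀_bijective _ _).1 (by rw [← he, Ext.mk₀_comp_mk₀])⟩

theorem subsingleton_ext_of_exists_extension {W : ModuleCat.{u} R}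
    (h₂ : Subsingleton (Ext S.X₂ W 1))
    (h : ∀ φ : S.X₁ ⟶ W, ∃ ψ : S.X₂ ⟶ W, S.f ≫ ψ = φ) : Subsingleton (Ext S.X₃ W 1) := by
  refine subsingleton_of_forall_eq 0 fun e => ?_
  obtain ⟨e₀, rfl⟩ := Ext.contravariant_sequence_exact₃ hS W e (Subsingleton.elim _ _) (add_zero 1)
  obtain ⟨φ, rfl⟩ := (Ext.mk₀_bijective _ _).2 e₀
  obtain ⟨ψ, rfl⟩ := h φ
  rw [← Ext.mk₀_comp_mk₀, ← Ext.comp_assoc _ _ _ (add_zero 1) (add_zero 0) (by simp),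
    hS.extClass_comp]
  simp

theorem subsingleton_ext_of_exists_lift {W : ModuleCat.{u} R}
    (h₂ : Subsingleton (Ext W S.X₂ 1))
    (h : ∀ φ : W ⟶ S.X₃, ∃ ψ : W ⟶ S.X₂, ψ ≫ S.g = φ) : Subsingleton (Ext W S.X₁ 1) := by
  refine subsingleton_of_forall_eq 0 fun e => ?_
  obtain ⟨e₀, rfl⟩ := Ext.covariant_sequence_exact₁ W hS e (Subsingleton.elim _ _) (zero_add 1)
  obtain ⟨φ, rfl⟩ := (Ext.mk₀_bijective _ _).2 e₀
  obtain ⟨ψ, rfl⟩ := h φ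
  rw [← Ext.mk₀_comp_mk₀, Ext.comp_assoc _ _ _ (add_zero 0) (zero_add 1) (by simp),
    hS.comp_extClass]
  simp

end Ext

/-! ### Acyclicity and cycles of complexes of modules -/

section Complexes
variable (T : ChainComplex (ModuleCat.{u} R) ℤ)

theorem acyclic_iff_exact : T.Acyclic ↔ ∀ n : ℤ,
    (ShortComplex.mk (T.d (n + 1 + 1) (n + 1)) (T.d (n + 1) n) (T.d_comp_d _ _ _)).Exact := by
  have key (n : ℤ) := T.exactAt_iff' (n + 1 + 1) (n + 1) n (by simp) (by simp)
  refine ⟨fun h n => (key n).1 (h _), fun h n => ?_⟩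
  obtain ⟨m, rfl⟩ : ∃ m, n = m + 1 := ⟨n - 1, by ring⟩
  exact (key m).2 (h m)

theorem acyclic_homFrom_iff (W : ModuleCat.{u} R) : (homFrom W T).Acyclic ↔
    ∀ (n : ℤ) (φ : W ⟶ T.X (n + 1)), φ ≫ T.d (n + 1) n = 0 →
      ∃ ψ : W ⟶ T.X (n + 1 + 1), ψ ≫ T.d (n + 1 + 1) (n + 1) = φ := by
  have key (n : ℤ) := ((homFrom W T).exactAt_iff' (n + 1 + 1) (n + 1) n (by simp) (by simp)).trans
    (ShortComplex.ab_exact_iff _)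
  refine ⟨fun h n => (key n).1 (h _), fun h n => ?_⟩
  obtain ⟨m, rfl⟩ : ∃ m, n = m + 1 := ⟨n - 1, by ring⟩
  exact (key m).2 (h m)

theorem acyclic_homInto_iff (W : ModuleCat.{u} R) : (homInto T W).Acyclic ↔
    ∀ (n : ℤ) (φ : T.X (n + 1) ⟶ W), T.d (n + 1 + 1) (n + 1) ≫ φ = 0 →
      ∃ ψ : T.X n ⟶ W, T.d (n + 1) n ≫ ψ = φ := by
  have key (n : ℤ) := ((homInto T W).exactAt_iff' n (n + 1) (n + 1 + 1)
    (ComplexShape.prev_eq' _ rfl) (ComplexShape.next_eq' _ rfl)).trans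
    (ShortComplex.ab_exact_iff _)
  refine ⟨fun h n => (key n).1 (h _), fun h n => ?_⟩
  obtain ⟨m, rfl⟩ : ∃ m, n = m + 1 := ⟨n - 1, by ring⟩
  exact (key m).2 (h m)

theorem iCycles_comp_toCycles (i j : ℤ) : T.iCycles i ≫ T.toCycles i j = 0 := by
  simp [← cancel_mono (T.iCycles j)]

theorem shortExact_cycles (hT : T.Acyclic) (n : ℤ) :
    (ShortComplex.mk (T.iCycles (n + 1)) (T.toCycles (n + 1) n)
      (iCycles_comp_toCycles T _ _)).ShortExact := by
  have hn' : (ComplexShape.down ℤ).next (n + 1) = n := by simp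
  have he : Epi (T.toCycles (n + 1) n) := by
    obtain ⟨m, rfl⟩ : ∃ m, n = m + 1 := ⟨n - 1, by ring⟩
    have h := (acyclic_iff_exact T).1 hT m
    rw [ModuleCat.epi_iff_surjective]
    intro x
    obtain ⟨y, hy⟩ := (ShortComplex.moduleCat_exact_iff _).1 h (T.iCycles (m + 1) x) (by
      simp [← ConcreteCategory.comp_apply])
    refine ⟨y, (ModuleCat.mono_iff_injective (T.iCycles (m + 1))).1 inferInstance ?_⟩
    rw [← ConcreteCategory.comp_apply, T.toCycles_i]
    exact hy
  refine ShortComplex.ShortExact.mk' (ShortComplex.exact_of_f_is_kernel _ ?_) inferInstance he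
  refine Limits.KernelFork.IsLimit.ofι' _ _ fun {A} (k : A ⟶ T.X (n + 1)) hk => ?_
  have hk' : k ≫ T.d (n + 1) n = 0 := by
    dsimp only at hk
    rw [← T.toCycles_i, reassoc_of% hk, Limits.zero_comp]
  exact ⟨T.liftCycles k n hn' hk', T.liftCycles_i k n hn' hk'⟩

end Complexes

/-! ### Gorenstein classes and splicing -/

/-- A class `P` of modules is a Gorenstein class if it is `Ext¹`-orthogonal on both sides to the
flat-cotorsion modules and each of its members embeds into a flat-cotorsion module with cokernel in
`P`, and is a quotient of a flat-cotorsion module with kernel in `P`. -/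
structure IsGorensteinClass (P : ModuleCat.{u} R → Prop) : Prop where
  coresolution {X : ModuleCat.{u} R} (hX : P X) : ∃ (W Y : ModuleCat.{u} R) (f : X ⟶ W)
    (g : W ⟶ Y) (w : f ≫ g = 0), (ShortComplex.mk f g w).ShortExact ∧ IsFlatCotorsion W ∧ P Y
  resolution {X : ModuleCat.{u} R} (hX : P X) : ∃ (Y W : ModuleCat.{u} R) (f : Y ⟶ W)
    (g : W ⟶ X) (w : f ≫ g = 0), (ShortComplex.mk f g w).ShortExact ∧ IsFlatCotorsion W ∧ P Y
  ext_left {X : ModuleCat.{u} R} (hX : P X) {W : ModuleCat.{u} R} (hW : IsFlatCotorsion W) :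
    Subsingleton (Abelian.Ext X W 1)
  ext_right {X : ModuleCat.{u} R} (hX : P X) {W : ModuleCat.{u} R} (hW : IsFlatCotorsion W) :
    Subsingleton (Abelian.Ext W X 1)

/-- Given a relation that is total on both sides, each element is the value in degree `m` of a
two-sided infinite chain. -/
theorem exists_int_chain {S : Type*} (r : S → S → Prop) (hl : ∀ x, ∃ y, r y x)
    (hr : ∀ x, ∃ y, r x y) (x : S) (m : ℤ) :
    ∃ Z : ℤ → S, Z m = x ∧ ∀ n, r (Z (n + 1)) (Z n) := by
  choose a ha using hr
  choose b hb using hl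
  -- `Int.negSucc n` stands for `-(n + 1)`, whence `n + 1` applications of `a`.
  let Z : ℤ → S := Int.rec (fun n => b^[n] x) (fun n => a^[n + 1] x)
  have hZ (n : ℤ) : r (Z (n + 1)) (Z n) := by
    rcases n with n | n
    · change r (b^[n + 1] x) (b^[n] x)
      rw [Function.iterate_succ_apply']
      exact hb _
    · rcases n with _ | n
      · exact ha x
      · change r (a^[n + 1] x) (a^[n + 2] x)
        rw [Function.iterate_succ_apply' a (n + 1)]
        exact ha _
  refine ⟨fun n => Z (n - m), congrArg Z (sub_self m), fun n => ?_⟩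
  have := hZ (n - m)
  rwa [show n - m + 1 = n + 1 - m by ring] at this

section Splice

/- A complex `T` whose differentials are the composites `T (n + 1) → Z (n + 1) → T n` for short exact
sequences `0 → Z (n + 1) → T n → Z n → 0`. -/
variable {T : ChainComplex (ModuleCat.{u} R) ℤ} {Z : ℤ → ModuleCat.{u} R}
  {f : ∀ n, Z (n + 1) ⟶ T.X n} {g : ∀ n, T.X n ⟶ Z n} {w : ∀ n, f n ≫ g n = 0}
  (h : ∀ n, (ShortComplex.mk (f n) (g n) (w n)).ShortExact)
  (hd : ∀ n, T.d (n + 1) n = g (n + 1) ≫ f n)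

include h hd

theorem acyclic_of_splice : T.Acyclic := by
  refine (acyclic_iff_exact _).2 fun n => (ShortComplex.moduleCat_exact_iff _).2 fun x hx => ?_
  dsimp only at x hx ⊢
  simp only [hd] at hx ⊢
  have hx' : g (n + 1) x = 0 := (h n).moduleCat_injective_f (by simpa using hx)
  obtain ⟨y, hy⟩ := (ShortComplex.moduleCat_exact_iff _).1 (h (n + 1)).exact x hx'
  obtain ⟨z, hz⟩ := (h (n + 1 + 1)).moduleCat_surjective_g y
  exact ⟨z, (congrArg (f (n + 1)) hz).trans hy⟩

theorem acyclic_homFrom_of_splice {W : ModuleCat.{u} R}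
    (hW : ∀ n, Subsingleton (Abelian.Ext W (Z n) 1)) : (homFrom W T).Acyclic := by
  refine (acyclic_homFrom_iff _ _).2 fun n φ hφ => ?_
  have : Mono (f n) := (h n).mono_f
  have := (h (n + 1)).mono_f
  have hφ' : φ ≫ g (n + 1) = 0 := by
    rw [← cancel_mono (f n), Category.assoc, ← hd, hφ, Limits.zero_comp]
  obtain ⟨ψ, hψ⟩ := exists_lift (h (n + 1 + 1)) (hW _) ((h (n + 1)).exact.lift φ hφ')
  refine ⟨ψ, ?_⟩
  dsimp only at hψ
  rw [hd, reassoc_of% hψ]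
  exact (h (n + 1)).exact.lift_f φ hφ'

theorem acyclic_homInto_of_splice {W : ModuleCat.{u} R}
    (hW : ∀ n, Subsingleton (Abelian.Ext (Z n) W 1)) : (homInto T W).Acyclic := by
  refine (acyclic_homInto_iff _ _).2 fun n φ hφ => ?_
  have : Epi (g (n + 1 + 1)) := (h (n + 1 + 1)).epi_g
  have := (h (n + 1)).epi_g
  have hφ' : f (n + 1) ≫ φ = 0 := by
    rw [← cancel_epi (g (n + 1 + 1)), ← Category.assoc, ← hd, hφ, Limits.comp_zero]
  obtain ⟨ψ, hψ⟩ := exists_extension (h n) (hW _) ((h (n + 1)).exact.desc φ hφ')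
  refine ⟨ψ, ?_⟩
  dsimp only at hψ
  rw [hd, Category.assoc, hψ]
  exact (h (n + 1)).exact.g_desc φ hφ'

theorem nonempty_cycles_iso_of_splice (n : ℤ) : Nonempty (T.cycles n ≅ Z (n + 1)) := by
  obtain ⟨m, rfl⟩ : ∃ m, n = m + 1 := ⟨n - 1, by ring⟩
  have : Mono (f m) := (h m).mono_f
  have := (h (m + 1)).mono_f
  have h₂ : Limits.IsLimit (Limits.KernelFork.ofι (f := T.d (m + 1) m) (f (m + 1))
      (by rw [hd, reassoc_of% w (m + 1), Limits.zero_comp])) := by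
    have := (h (m + 1)).mono_f
    refine Limits.KernelFork.IsLimit.ofι' _ _ fun k hk => ?_
    have hk' : k ≫ g (m + 1) = 0 := by
      rw [← cancel_mono (f m), Category.assoc, Limits.zero_comp, ← hd, hk]
    exact ⟨(h (m + 1)).exact.lift k hk', (h (m + 1)).exact.lift_f k hk'⟩
  exact ⟨(T.cyclesIsKernel (m + 1) m (by simp)).conePointUniqueUpToIso h₂⟩

end Splice

theorem IsGorensteinClass.isGorensteinFlatCotorsion {P : ModuleCat.{u} R → Prop}
    (hP : IsGorensteinClass P) {X : ModuleCat.{u} R} (hX : P X) :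
    IsGorensteinFlatCotorsion X := by
  obtain ⟨Z, hZ, hr⟩ := exists_int_chain (S := {X // P X})
    (fun Y X => ∃ (W : ModuleCat.{u} R) (f : Y.1 ⟶ W) (g : W ⟶ X.1) (w : f ≫ g = 0),
      (ShortComplex.mk f g w).ShortExact ∧ IsFlatCotorsion W)
    (fun X => by
      obtain ⟨Y, W, f, g, w, h, hW, hY⟩ := hP.resolution X.2
      exact ⟨⟨Y, hY⟩, W, f, g, w, h, hW⟩)
    (fun X => by
      obtain ⟨W, Y, f, g, w, h, hW, hY⟩ := hP.coresolution X.2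
      exact ⟨⟨Y, hY⟩, W, f, g, w, h, hW⟩) ⟨X, hX⟩ (0 + 1)
  choose E f g w h hE using hr
  -- The `eqToHom`s disappear once `E` is replaced by `T.X`, so that everything below is typed by `T`.
  obtain ⟨T, rfl, hd⟩ : ∃ T : ChainComplex (ModuleCat.{u} R) ℤ, ∃ hX : T.X = E, ∀ n,
      T.d (n + 1) n = eqToHom (congrFun hX _) ≫ g (n + 1) ≫ f n ≫ eqToHom (congrFun hX _).symm :=
    ⟨ChainComplex.of E (fun n => g (n + 1) ≫ f n) fun n => by simp [reassoc_of% w (n + 1)], rfl,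
      fun n => by simp⟩
  simp only [eqToHom_refl, Category.id_comp, Category.comp_id] at hd
  refine ⟨T, ⟨hE, acyclic_of_splice h hd, fun W hW => ?_, fun W hW => ?_⟩, ?_⟩
  · exact acyclic_homInto_of_splice h hd fun n => hP.ext_left (Z n).2 hW
  · exact acyclic_homFrom_of_splice h hd fun n => hP.ext_right (Z n).2 hW
  · obtain ⟨e⟩ := nonempty_cycles_iso_of_splice h hd 0
    exact ⟨e ≪≫ eqToIso (congrArg Subtype.val hZ)⟩

/-! ### Gorenstein flat-cotorsion modules form a Gorenstein class -/

theorem IsTotallyAcyclic.exists_extension_cycles {T : ChainComplex (ModuleCat.{u} R) ℤ}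
    (hT : IsTotallyAcyclic T) {W : ModuleCat.{u} R} (hW : IsFlatCotorsion W) (n : ℤ)
    (φ : T.cycles (n + 1) ⟶ W) : ∃ ψ : T.X (n + 1) ⟶ W, T.iCycles (n + 1) ≫ ψ = φ := by
  have he := (shortExact_cycles T hT.acyclic (n + 1)).epi_g
  obtain ⟨ψ, hψ⟩ := (acyclic_homInto_iff T W).1 (hT.acyclic_homInto W hW) (n + 1)
    (T.toCycles (n + 1 + 1) (n + 1) ≫ φ) (by simp)
  dsimp only at he
  refine ⟨ψ, ?_⟩
  rw [← cancel_epi (T.toCycles (n + 1 + 1) (n + 1)), ← Category.assoc, T.toCycles_i, hψ]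

theorem IsTotallyAcyclic.exists_lift_cycles {T : ChainComplex (ModuleCat.{u} R) ℤ}
    (hT : IsTotallyAcyclic T) {W : ModuleCat.{u} R} (hW : IsFlatCotorsion W) (n : ℤ)
    (φ : W ⟶ T.cycles n) : ∃ ψ : W ⟶ T.X (n + 1), ψ ≫ T.toCycles (n + 1) n = φ := by
  obtain ⟨m, rfl⟩ : ∃ m, n = m + 1 := ⟨n - 1, by ring⟩
  obtain ⟨ψ, hψ⟩ := (acyclic_homFrom_iff T W).1 (hT.acyclic_homFrom W hW) m
    (φ ≫ T.iCycles (m + 1)) (by simp)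
  refine ⟨ψ, ?_⟩
  rw [← cancel_mono (T.iCycles (m + 1)), Category.assoc, T.toCycles_i, hψ]

theorem IsTotallyAcyclic.isGorensteinClass_cycles {T : ChainComplex (ModuleCat.{u} R) ℤ}
    (hT : IsTotallyAcyclic T) : IsGorensteinClass fun X => ∃ n, X = T.cycles n where
  coresolution := by
    rintro _ ⟨n, rfl⟩
    obtain ⟨m, rfl⟩ : ∃ m, n = m + 1 := ⟨n - 1, by ring⟩
    exact ⟨_, _, _, _, _, shortExact_cycles T hT.acyclic m, hT.isFlatCotorsion _, m, rfl⟩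
  resolution := by
    rintro _ ⟨n, rfl⟩
    exact ⟨_, _, _, _, _, shortExact_cycles T hT.acyclic n, hT.isFlatCotorsion _, n + 1, rfl⟩
  ext_left := by
    rintro _ ⟨n, rfl⟩ W hW
    exact subsingleton_ext_of_exists_extension (shortExact_cycles T hT.acyclic n)
      (hW.2 _ (hT.isFlatCotorsion _).1) (hT.exists_extension_cycles hW n)
  ext_right := by
    rintro _ ⟨n, rfl⟩ W hW
    obtain ⟨m, rfl⟩ : ∃ m, n = m + 1 := ⟨n - 1, by ring⟩
    exact subsingleton_ext_of_exists_lift (shortExact_cycles T hT.acyclic m)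
      ((hT.isFlatCotorsion _).2 _ hW.1) (hT.exists_lift_cycles hW m)

theorem IsGorensteinFlatCotorsion.of_iso {X Y : ModuleCat.{u} R}
    (hX : IsGorensteinFlatCotorsion X) (e : X ≅ Y) : IsGorensteinFlatCotorsion Y :=
  let ⟨T, hT, ⟨e'⟩⟩ := hX
  ⟨T, hT, ⟨e' ≪≫ e⟩⟩

/-- The closure of a Gorenstein class under isomorphisms is a Gorenstein class. -/
theorem IsGorensteinClass.of_iso {P : ModuleCat.{u} R → Prop} (hP : IsGorensteinClass P) :
    IsGorensteinClass fun X => ∃ X', P X' ∧ Nonempty (X ≅ X') where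
  coresolution := by
    rintro X ⟨X', hX', ⟨e⟩⟩
    obtain ⟨W, Y, f, g, w, h, hW, hY⟩ := hP.coresolution hX'
    have w' : (e.hom ≫ f) ≫ g = 0 := by simp [w]
    have i : ShortComplex.mk f g w ≅ ShortComplex.mk (e.hom ≫ f) g w' :=
      ShortComplex.isoMk e.symm (Iso.refl _) (Iso.refl _)
    exact ⟨W, Y, _, _, w', ShortComplex.shortExact_of_iso i h, hW, Y, hY, ⟨Iso.refl _⟩⟩
  resolution := by
    rintro X ⟨X', hX', ⟨e⟩⟩
    obtain ⟨Y, W, f, g, w, h, hW, hY⟩ := hP.resolution hX'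
    have w' : f ≫ g ≫ e.inv = 0 := by simp [reassoc_of% w]
    have i : ShortComplex.mk f g w ≅ ShortComplex.mk f (g ≫ e.inv) w' :=
      ShortComplex.isoMk (Iso.refl _) (Iso.refl _) e.symm
    exact ⟨Y, W, _, _, w', ShortComplex.shortExact_of_iso i h, hW, Y, hY, ⟨Iso.refl _⟩⟩
  ext_left := by
    rintro X ⟨X', hX', ⟨e⟩⟩ W hW
    exact subsingleton_ext_of_retract e.retract (.refl W) (hP.ext_left hX' hW)
  ext_right := by
    rintro X ⟨X', hX', ⟨e⟩⟩ W hW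
    exact subsingleton_ext_of_retract (.refl W) e.retract (hP.ext_right hX' hW)

theorem isGorensteinClass_isGorensteinFlatCotorsion :
    IsGorensteinClass (IsGorensteinFlatCotorsion (R := R)) where
  coresolution := by
    rintro X ⟨T, hT, ⟨e⟩⟩
    obtain ⟨W, Y, f, g, w, h, hW, hY⟩ :=
      hT.isGorensteinClass_cycles.of_iso.coresolution ⟨_, ⟨0, rfl⟩, ⟨e.symm⟩⟩
    exact ⟨W, Y, f, g, w, h, hW, hT.isGorensteinClass_cycles.of_iso.isGorensteinFlatCotorsion hY⟩
  resolution := by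
    rintro X ⟨T, hT, ⟨e⟩⟩
    obtain ⟨W, Y, f, g, w, h, hW, hY⟩ :=
      hT.isGorensteinClass_cycles.of_iso.resolution ⟨_, ⟨0, rfl⟩, ⟨e.symm⟩⟩
    exact ⟨W, Y, f, g, w, h, hW, hT.isGorensteinClass_cycles.of_iso.isGorensteinFlatCotorsion hY⟩
  ext_left := by
    rintro X ⟨T, hT, ⟨e⟩⟩ W hW
    exact hT.isGorensteinClass_cycles.of_iso.ext_left ⟨_, ⟨0, rfl⟩, ⟨e.symm⟩⟩ hW
  ext_right := by
    rintro X ⟨T, hT, ⟨e⟩⟩ W hW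
    exact hT.isGorensteinClass_cycles.of_iso.ext_right ⟨_, ⟨0, rfl⟩, ⟨e.symm⟩⟩ hW

/-! ### Finite sums -/

open Limits
open scoped ZeroObject

theorem sum_proj_comp_single {ι : Type} [Fintype ι] [DecidableEq ι] (A : ι → ModuleCat.{u} R) :
    ∑ i, (ModuleCat.ofHom (LinearMap.proj i) : ModuleCat.of R (∀ i, A i) ⟶ A i) ≫
      ModuleCat.ofHom (LinearMap.single R (fun i => A i) i) = 𝟙 _ := by
  refine ModuleCat.hom_ext (LinearMap.ext fun x => ?_)
  simp only [ModuleCat.hom_sum, ModuleCat.hom_comp, ModuleCat.hom_ofHom, LinearMap.sum_apply,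
    LinearMap.comp_apply, LinearMap.proj_apply]
  exact Finset.univ_sum_single x

theorem shortExact_pi {ι : Type} {X W Y : ι → ModuleCat.{u} R} {f : ∀ i, X i ⟶ W i}
    {g : ∀ i, W i ⟶ Y i} {w : ∀ i, f i ≫ g i = 0}
    (h : ∀ i, (ShortComplex.mk (f i) (g i) (w i)).ShortExact) :
    ∃ w', (ShortComplex.mk
      (ModuleCat.ofHom (LinearMap.piMap fun i => (f i).hom) :
        ModuleCat.of R (∀ i, X i) ⟶ ModuleCat.of R (∀ i, W i))
      (ModuleCat.ofHom (LinearMap.piMap fun i => (g i).hom) :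
        ModuleCat.of R (∀ i, W i) ⟶ ModuleCat.of R (∀ i, Y i)) w').ShortExact := by
  refine ⟨?_, ModuleCat.shortComplex_shortExact _ ?_ ?_ ?_⟩
  · ext x i
    exact congr(($(w i)).hom (x i))
  · intro y
    refine ⟨fun hy => ?_, ?_⟩
    · choose x hx using fun i => (ShortComplex.moduleCat_exact_iff _).1 (h i).exact (y i)
        (congrFun hy i)
      exact ⟨x, funext hx⟩
    · rintro ⟨x, rfl⟩
      exact funext fun i => congr(($(w i)).hom (x i))
  · exact Function.Injective.piMap fun i => (h i).moduleCat_injective_f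
  · exact Function.Surjective.piMap fun i => (h i).moduleCat_surjective_g

theorem isGorensteinClass_pi (ι : Type) [Finite ι] :
    IsGorensteinClass fun X : ModuleCat.{u} R => ∃ G : ι → ModuleCat.{u} R,
      (∀ i, IsGorensteinFlatCotorsion (G i)) ∧ X = ModuleCat.of R (∀ i, G i) := by
  classical
  have := Fintype.ofFinite ι
  constructor
  · rintro _ ⟨G, hG, rfl⟩
    choose W Y f g w h hW hY using fun i =>
      isGorensteinClass_isGorensteinFlatCotorsion.coresolution (hG i)
    obtain ⟨w', h'⟩ := shortExact_pi h
    exact ⟨_, _, _, _, w', h', .of_sum_eq_id _ _ (sum_proj_comp_single W) hW, Y, hY, rfl⟩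
  · rintro _ ⟨G, hG, rfl⟩
    choose Y W f g w h hW hY using fun i =>
      isGorensteinClass_isGorensteinFlatCotorsion.resolution (hG i)
    obtain ⟨w', h'⟩ := shortExact_pi h
    exact ⟨_, _, _, _, w', h', .of_sum_eq_id _ _ (sum_proj_comp_single W) hW, Y, hY, rfl⟩
  · rintro _ ⟨G, hG, rfl⟩ W hW
    exact subsingleton_ext_left_of_sum_eq_id _ _ (sum_proj_comp_single G) fun i =>
      isGorensteinClass_isGorensteinFlatCotorsion.ext_left (hG i) hW
  · rintro _ ⟨G, hG, rfl⟩ W hW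
    exact subsingleton_ext_right_of_sum_eq_id _ _ (sum_proj_comp_single G) fun i =>
      isGorensteinClass_isGorensteinFlatCotorsion.ext_right (hG i) hW

theorem IsGorensteinFlatCotorsion.pi {ι : Type} [Finite ι] {G : ι → ModuleCat.{u} R}
    (hG : ∀ i, IsGorensteinFlatCotorsion (G i)) :
    IsGorensteinFlatCotorsion (ModuleCat.of R (∀ i, G i)) :=
  (isGorensteinClass_pi ι).isGorensteinFlatCotorsion ⟨G, hG, rfl⟩

theorem IsFlatCotorsion.of_isZero {X : ModuleCat.{u} R} (hX : IsZero X) : IsFlatCotorsion X :=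
  .of_sum_eq_id (ι := Empty) (A := fun _ => X) (fun _ => 0) (fun _ => 0) (hX.eq_of_src _ _)
    nofun

/-- The sequences `0 → X → X → 0 → 0` and `0 → 0 → X → X → 0` make the flat-cotorsion modules a
Gorenstein class. -/
theorem isGorensteinClass_isFlatCotorsion : IsGorensteinClass (IsFlatCotorsion (R := R)) where
  coresolution {X} hX := ⟨X, 0, 𝟙 X, 0, comp_zero, .mk' (ShortComplex.exact_of_f_is_kernel _
    (KernelFork.IsLimit.ofId _ rfl)) inferInstance inferInstance, hX, .of_isZero (isZero_zero _)⟩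
  resolution {X} hX := ⟨0, X, 0, 𝟙 X, zero_comp, .mk' (ShortComplex.exact_of_g_is_cokernel _
    (CokernelCofork.IsColimit.ofId _ rfl)) inferInstance inferInstance, hX,
    .of_isZero (isZero_zero _)⟩
  ext_left hX _ hW := hW.2 _ hX.1
  ext_right hX _ hW := hX.2 _ hW.1

theorem IsFlatCotorsion.isGorensteinFlatCotorsion {W : ModuleCat.{u} R} (hW : IsFlatCotorsion W) :
    IsGorensteinFlatCotorsion W :=
  isGorensteinClass_isFlatCotorsion.isGorensteinFlatCotorsion hW

theorem IsGorensteinFlatCotorsion.biprod {X Y : ModuleCat.{u} R}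
    (hX : IsGorensteinFlatCotorsion X) (hY : IsGorensteinFlatCotorsion Y) :
    IsGorensteinFlatCotorsion (X ⊞ Y) :=
  let G : Bool → ModuleCat.{u} R := fun b => cond b X Y
  let p : ModuleCat.of R (∀ b, G b) ⟶ X := ModuleCat.ofHom (LinearMap.proj true)
  let q : ModuleCat.of R (∀ b, G b) ⟶ Y := ModuleCat.ofHom (LinearMap.proj false)
  (IsGorensteinFlatCotorsion.pi (G := G) (Bool.rec hY hX)).of_iso
    { hom := biprod.lift p q
      inv := ModuleCat.ofHom (LinearMap.pi (Bool.rec (biprod.snd : X ⊞ Y ⟶ Y).hom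
        (biprod.fst : X ⊞ Y ⟶ X).hom))
      hom_inv_id := by
        refine ModuleCat.hom_ext (LinearMap.ext fun x => funext fun b => ?_)
        cases b
        · exact congr(($(biprod.lift_snd p q)).hom x)
        · exact congr(($(biprod.lift_fst p q)).hom x)
      inv_hom_id := by
        apply biprod.hom_ext
        · rw [Category.assoc, biprod.lift_fst, Category.id_comp]
          rfl
        · rw [Category.assoc, biprod.lift_snd, Category.id_comp]
          rfl }

/-! ### Direct summands -/

/-- If `0 → M → W → N → 0` is exact with `Ext¹(N, W) = 0` and `G` is a retract of `M`, then the
cokernel of `G → M → W` is a retract of `W ⊞ N`. -/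
theorem nonempty_retract_biprod_of_coresolution {M G W N Q : ModuleCat.{u} R} (ρ : Retract G M)
    {i : M ⟶ W} {q : W ⟶ N} {w : i ≫ q = 0} (h : (ShortComplex.mk i q w).ShortExact)
    (hN : Subsingleton (Abelian.Ext N W 1)) {π : W ⟶ Q} {w' : (ρ.i ≫ i) ≫ π = 0}
    (h' : (ShortComplex.mk (ρ.i ≫ i) π w').ShortExact) : Nonempty (Retract Q (W ⊞ N)) := by
  have := h.epi_g
  have := h'.epi_g
  have : Epi π := h'.epi_g
  -- `e` extends the idempotent `ρ.r ≫ ρ.i` of `M` to `W`.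
  obtain ⟨e, he⟩ : ∃ e : W ⟶ W, i ≫ e = ρ.r ≫ ρ.i ≫ i := exists_extension h hN _
  have hs : (ρ.i ≫ i) ≫ biprod.lift (𝟙 W - e) q = 0 := by
    apply biprod.hom_ext <;> simp [w, he]
  have hr : i ≫ e ≫ π = 0 := by
    rw [Category.assoc] at w'
    rw [reassoc_of% he, w', comp_zero]
  have hs' : π ≫ h'.exact.desc _ hs = _ := h'.exact.g_desc _ hs
  have hr' : q ≫ h.exact.desc _ hr = _ := h.exact.g_desc _ hr
  refine ⟨⟨h'.exact.desc _ hs, biprod.desc π (h.exact.desc _ hr), ?_⟩⟩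
  rw [← cancel_epi π, reassoc_of% hs', biprod.lift_desc, hr']
  simp

/-- If `0 → N → W → M → 0` is exact with `Ext¹(W, N) = 0` and `G` is a retract of `M`, then the
kernel of `W → M → G` is a retract of `W ⊞ N`. -/
theorem nonempty_retract_biprod_of_resolution {M G W N K : ModuleCat.{u} R} (ρ : Retract G M)
    {i : N ⟶ W} {q : W ⟶ M} {w : i ≫ q = 0} (h : (ShortComplex.mk i q w).ShortExact)
    (hN : Subsingleton (Abelian.Ext W N 1)) {κ : K ⟶ W} {w' : κ ≫ q ≫ ρ.r = 0}
    (h' : (ShortComplex.mk κ (q ≫ ρ.r) w').ShortExact) : Nonempty (Retract K (W ⊞ N)) := by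
  have := h.mono_f
  have := h'.mono_f
  have : Mono κ := h'.mono_f
  -- `e` lifts the idempotent `ρ.r ≫ ρ.i` of `M` to `W`.
  obtain ⟨e, he⟩ : ∃ e : W ⟶ W, e ≫ q = q ≫ ρ.r ≫ ρ.i := exists_lift h hN _
  have hr : biprod.desc (𝟙 W - e) i ≫ q ≫ ρ.r = 0 := by
    apply biprod.hom_ext' <;> simp [reassoc_of% w, reassoc_of% he]
  have hs : (κ ≫ e) ≫ q = 0 := by
    rw [Category.assoc, he, reassoc_of% w', zero_comp]
  have hs' : h.exact.lift _ hs ≫ i = _ := h.exact.lift_f _ hs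
  have hr' : h'.exact.lift _ hr ≫ κ = _ := h'.exact.lift_f _ hr
  refine ⟨⟨biprod.lift κ (h.exact.lift _ hs), h'.exact.lift _ hr, ?_⟩⟩
  rw [← cancel_mono κ, Category.assoc, hr', biprod.lift_desc, hs']
  simp

theorem isGorensteinClass_retract : IsGorensteinClass fun G : ModuleCat.{u} R =>
    ∃ M, IsGorensteinFlatCotorsion M ∧ Nonempty (Retract G M) where
  coresolution := by
    rintro G ⟨M, hM, ⟨ρ⟩⟩
    obtain ⟨W, N, i, q, w, h, hW, hN⟩ :=
      isGorensteinClass_isGorensteinFlatCotorsion.coresolution hM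
    have : Mono i := h.mono_f
    have h' : (ShortComplex.mk (ρ.i ≫ i) (cokernel.π _) (cokernel.condition _)).ShortExact :=
      .mk' (ShortComplex.exact_cokernel _) (mono_comp _ _) inferInstance
    exact ⟨W, _, _, _, _, h', hW, _, hW.isGorensteinFlatCotorsion.biprod hN,
      nonempty_retract_biprod_of_coresolution ρ h
        (isGorensteinClass_isGorensteinFlatCotorsion.ext_left hN hW) h'⟩
  resolution := by
    rintro G ⟨M, hM, ⟨ρ⟩⟩
    obtain ⟨N, W, i, q, w, h, hW, hN⟩ :=
      isGorensteinClass_isGorensteinFlatCotorsion.resolution hM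
    have : Epi q := h.epi_g
    have h' : (ShortComplex.mk (kernel.ι _) (q ≫ ρ.r) (kernel.condition _)).ShortExact :=
      .mk' (ShortComplex.exact_kernel _) inferInstance (epi_comp _ _)
    exact ⟨_, W, _, _, _, h', hW, _, hW.isGorensteinFlatCotorsion.biprod hN,
      nonempty_retract_biprod_of_resolution ρ h
        (isGorensteinClass_isGorensteinFlatCotorsion.ext_right hN hW) h'⟩
  ext_left := by
    rintro G ⟨M, hM, ⟨ρ⟩⟩ W hW
    exact subsingleton_ext_of_retract ρ (.refl W)
      (isGorensteinClass_isGorensteinFlatCotorsion.ext_left hM hW)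
  ext_right := by
    rintro G ⟨M, hM, ⟨ρ⟩⟩ W hW
    exact subsingleton_ext_of_retract (.refl W) ρ
      (isGorensteinClass_isGorensteinFlatCotorsion.ext_right hM hW)

theorem IsGorensteinFlatCotorsion.of_retract {G M : ModuleCat.{u} R}
    (hM : IsGorensteinFlatCotorsion M) (ρ : Retract G M) : IsGorensteinFlatCotorsion G :=
  isGorensteinClass_retract.isGorensteinFlatCotorsion ⟨M, hM, ⟨ρ⟩⟩

end GorensteinFlatCotorsion

theorem mainTheorem11 (R : Type u) [Ring R] :
    (∀ (ι : Type) [Finite ι] (G : ι → ModuleCat.{u} R),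
      (∀ i, GorensteinFlatCotorsion.IsGorensteinFlatCotorsion (G i)) →
        GorensteinFlatCotorsion.IsGorensteinFlatCotorsion
          (ModuleCat.of R (DirectSum ι fun i => G i))) ∧
    (∀ G M : ModuleCat.{u} R,
      GorensteinFlatCotorsion.IsDirectSummand G M →
        GorensteinFlatCotorsion.IsGorensteinFlatCotorsion M →
          GorensteinFlatCotorsion.IsGorensteinFlatCotorsion G) := by
  classical
  constructor
  · intro ι _ G hG
    have := Fintype.ofFinite ι
    exact (GorensteinFlatCotorsion.IsGorensteinFlatCotorsion.pi hG).of_iso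
      (DirectSum.linearEquivFunOnFintype R ι fun i => G i).symm.toModuleIso
  · rintro G M ⟨G', ⟨e⟩⟩ hM
    exact (hM.of_iso e).of_retract
      { i := ModuleCat.ofHom (LinearMap.inl R G G')
        r := ModuleCat.ofHom (LinearMap.fst R G G') }
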